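/- Let $k_1,k_2,k_3$ be non-negative integers. Let $\mathcal F=\mathbb Q(x_1,x_2,x_3)$ and let $\mathbb T_3$ be the $3$-regular tree whose edges are labeled by $1,2,3$ so that the three edges at each vertex have different labels, with a root $t_0$. Put $c_j=2$ if $k_j=0$ and $c_j=1$ if $k_j\neq 0$. The generalized Markov cluster algebra $\mathcal A(k_1,k_2,k_3)$ is the generalized cluster algebra with trivial coefficients whose initial labeled seed $(\mathbf x,B,\mathbf Z)$, placed at $t_0$, is \[ \mathbf x=(x_1,x_2,x_3),\qquad B=\begin{bmatrix}0&-c_2&c_3\\ c_1&0&-c_3\\ -c_1&c_2&0\end{bmatrix},\qquad Z_j(u)=\begin{cases}1+u&\text{if }k_j=0,\\ 1+k_ju+u^2&\text{if }k_j\neq0.\end{cases} \] To every vertex $t$ of $\mathbb T_3$ a labeled seed $(\mathbf x_t,B_t,\mathbf Z_t)$ is assigned so that the seeds at the two ends of an edge labeled $k$ are obtained from each other by the mutation $\mu_k$. With $[b]_+=\max(b,0)$ and $d_k=\deg Z_k$, the mutation $\mu_k(\mathbf x,B,\mathbf Z)=(\mathbf x',B',\mathbf Z')$ is given by $x'_k=x_k^{-1}\bigl(\prod_i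 x_i^{[-b_{ik}]_+}\bigr)^{d_k}Z_k\bigl(\prod_i x_i^{b_{ik}}\bigr)$ and $x'_j=x_j$ for $j\ne k$; $b'_{ij}=-b_{ij}$ if $i=k$ or $j=k$, and $b'_{ij}=b_{ij}+d_k\bigl([b_{ik}]_+b_{kj}+b_{ik}[-b_{kj}]_+\bigr)$ otherwise; $Z'_k(u)=u^{d_k}Z_k(u^{-1})$ and $Z'_j=Z_j$ for $j\neq k$. The triples $\mathbf x_t=(x_{1;t},x_{2;t},x_{3;t})$ are the labeled clusters, and their entries $x_{i;t}\in\mathcal F$ are the cluster variables of $\mathcal A(k_1,k_2,k_3)$. Theorem. For every cluster variable $x$ of $\mathcal A(k_1,k_2,k_3)$ there is exactly one $i\in\{1,2,3\}$ such that $x=x_{i;t}$ for some vertex $t$ of $\mathbb T_3$; that is, $x$ occupies the same position $i$ in every labeled cluster that contains it. Consequently the parity of $x$, $k_x:=k_i$, where $i$ is a position at which $x$ appears, is well defined: exactly one value arises in this way. -/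

import Mathlib

/-!
Generalized cluster patterns with trivial coefficients, and the generalized Markov cluster
algebras `A(k₁, k₂, k₃)`.

The coefficient semifield is the one-element semifield `ℙ = {1}`. Hence `ℤℙ = ℤ`, every coefficient
tuple is `(1, …, 1)`, every value of an exchange polynomial in `ℙ` is `1`, and exchange
polynomials have natural-number coefficients. A labeled seed is therefore a triple `(x, B, Z)`.
-/

/-- The data `(x, B, Z)` of a labeled seed, with trivial coefficients, whose positions are indexed
by `ι` and whose cluster lies in the ambient field `F`. -/
@[ext]
structure LabeledSeed (ι : Type*) (F : Type*) where
  /-- the (labeled) cluster -/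
  cluster : ι → F
  /-- the exchange matrix -/
  B : Matrix ι ι ℤ
  /-- the exchange polynomials -/
  Z : ι → Polynomial ℕ

namespace LabeledSeed

variable {ι F : Type*} [Fintype ι] [DecidableEq ι] [Field F]

/-- The degree `d_k` of the `k`-th exchange polynomial. -/
def d (s : LabeledSeed ι F) (k : ι) : ℕ := (s.Z k).natDegree

/-- The new cluster variable
`x_k⁻¹ (∏ i, x_i ^ [-b_{ik}]₊) ^ d_k * Z_k (∏ i, x_i ^ b_{ik})` created by mutation in
direction `k`. -/
noncomputable def newVariable (s : LabeledSeed ι F) (k : ι) : F :=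
  (s.cluster k)⁻¹ * (∏ i, s.cluster i ^ max (-s.B i k) 0) ^ s.d k *
    (s.Z k).eval₂ (Nat.castRingHom F) (∏ i, s.cluster i ^ s.B i k)

/-- Seed mutation in direction `k`. Here `Polynomial.reverse Z = u ^ (deg Z) * Z (u⁻¹)`. -/
noncomputable def mutate (k : ι) (s : LabeledSeed ι F) : LabeledSeed ι F where
  cluster j := if j = k then s.newVariable k else s.cluster j
  B := Matrix.of fun i j =>
    if i = k ∨ j = k then -s.B i j
    else s.B i j + (s.d k : ℤ) * (max (s.B i k) 0 * s.B k j + s.B i k * max (-s.B k j) 0)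
  Z j := if j = k then (s.Z k).reverse else s.Z j

end LabeledSeed

/-- The vertices of the regular tree whose edges are labeled by `ι`, so that the edges at each
vertex carry each label exactly once. A vertex is encoded by the sequence of edge labels on the
unique path from it to the root (the label of the edge at the vertex itself comes first):
a word in which no two consecutive letters are equal. -/
def RegularTree (ι : Type*) : Type _ := {w : List ι // w.IsChain (· ≠ ·)}

/-- The generalized cluster pattern `t ↦ Σ_t` with initial seed `s₀` at the root: one moves along
the path from the root to `t` and mutates in the direction of each edge crossed. -/
noncomputable def clusterPattern {ι F : Type*} [Fintype ι] [DecidableEq ι] [Field F]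
    (s₀ : LabeledSeed ι F) (t : RegularTree ι) : LabeledSeed ι F :=
  t.1.foldr LabeledSeed.mutate s₀

namespace GenMarkov

/-- The field `ℚ(x₁, x₂, x₃)` of rational functions in three indeterminates. -/
abbrev AmbientField : Type := FractionRing (MvPolynomial (Fin 3) ℚ)

/-- The absolute value of the nonzero entries in the `j`-th column of the initial exchange
matrix. -/
def colEntry (k : Fin 3 → ℕ) (j : Fin 3) : ℤ := if k j = 0 then 2 else 1

/-- The initial labeled seed of `A(k₁, k₂, k₃)`, where `k 0, k 1, k 2` stand for `k₁, k₂, k₃`. -/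
noncomputable def initialSeed (k : Fin 3 → ℕ) : LabeledSeed (Fin 3) AmbientField where
  cluster i := algebraMap (MvPolynomial (Fin 3) ℚ) AmbientField (MvPolynomial.X i)
  B := !![0, -colEntry k 1, colEntry k 2;
          colEntry k 0, 0, -colEntry k 2;
          -colEntry k 0, colEntry k 1, 0]
  Z j := if k j = 0 then 1 + Polynomial.X
         else 1 + Polynomial.C (k j) * Polynomial.X + Polynomial.X ^ 2

/-- The labeled cluster `x_t = (x_{1;t}, x_{2;t}, x_{3;t})` of `A(k₁, k₂, k₃)` at `t`. -/
noncomputable def labeledCluster (k : Fin 3 → ℕ) (t : RegularTree (Fin 3)) :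
    Fin 3 → AmbientField :=
  (clusterPattern (initialSeed k) t).cluster

/-- `x` is a cluster variable of `A(k₁, k₂, k₃)`. -/
def IsClusterVariable (k : Fin 3 → ℕ) (x : AmbientField) : Prop :=
  ∃ (t : RegularTree (Fin 3)) (i : Fin 3), labeledCluster k t i = x

/-- `x` appears at position `i` in some labeled cluster of `A(k₁, k₂, k₃)`. -/
def AppearsAt (k : Fin 3 → ℕ) (x : AmbientField) (i : Fin 3) : Prop :=
  ∃ t : RegularTree (Fin 3), labeledCluster k t i = x

/-- `κ` is a parity of `x`: it is `k_i` for some position `i` at which `x` appears. -/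
def IsParity (k : Fin 3 → ℕ) (x : AmbientField) (κ : ℕ) : Prop :=
  ∃ i : Fin 3, AppearsAt k x i ∧ κ = k i

end GenMarkov

/-! The position of a cluster variable can be read off from its degrees modulo 2. Mutation only
changes the sign of `B` and fixes `Z`, so every exchange relation reads `f f' = g² + h² + c g h`
with `c ≥ 0`. By induction all cluster variables are quotients of positive polynomials; nothing
cancels, so the right side has even degree `2 max (deg g, deg h)` in each variable and `f'` has the
parity of `f`. Hence a variable at position `i` has odd degree in `x_i` and even degree in the other
two, as `x_i` itself does. -/

namespace MvPolynomial

variable {σ : Type*}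

/-- `P` is a nonzero polynomial with nonnegative coefficients. -/
def IsPositive (P : MvPolynomial σ ℚ) : Prop := P ≠ 0 ∧ ∀ m, 0 ≤ P.coeff m

/-! ### Positivity and degrees without cancellation -/

namespace IsPositive

variable {P Q : MvPolynomial σ ℚ}

theorem one : IsPositive (1 : MvPolynomial σ ℚ) := by
  classical
  refine ⟨one_ne_zero, fun m => ?_⟩
  rw [coeff_one]
  split_ifs <;> norm_num

theorem X (i : σ) : IsPositive (X i : MvPolynomial σ ℚ) := by
  classical
  refine ⟨X_ne_zero i, fun m => ?_⟩
  rw [coeff_X]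
  split_ifs <;> norm_num

theorem coeff_mul_nonneg (hP : ∀ m, 0 ≤ P.coeff m) (hQ : ∀ m, 0 ≤ Q.coeff m) (m : σ →₀ ℕ) :
    0 ≤ (P * Q).coeff m := by
  classical
  rw [coeff_mul]
  exact Finset.sum_nonneg fun p _ => mul_nonneg (hP _) (hQ _)

theorem mul (hP : IsPositive P) (hQ : IsPositive Q) : IsPositive (P * Q) :=
  ⟨mul_ne_zero hP.1 hQ.1, coeff_mul_nonneg hP.2 hQ.2⟩

theorem add_of_nonneg (hP : IsPositive P) (hQ : ∀ m, 0 ≤ Q.coeff m) : IsPositive (P + Q) := by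
  refine ⟨fun h => hP.1 ?_, fun m => by rw [coeff_add]; exact add_nonneg (hP.2 m) (hQ m)⟩
  ext m
  have h0 := congrArg (coeff m) h
  rw [coeff_add, coeff_zero] at h0
  rw [coeff_zero]
  linarith [hP.2 m, hQ m]

theorem degreeOf_le_add (l : σ) (hP : ∀ m, 0 ≤ P.coeff m) (hQ : ∀ m, 0 ≤ Q.coeff m) :
    degreeOf l P ≤ degreeOf l (P + Q) := by
  rw [degreeOf_le_iff]
  intro m hm
  refine monomial_le_degreeOf l ?_
  rw [mem_support_iff] at hm ⊢
  rw [coeff_add]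
  exact (add_pos_of_pos_of_nonneg (lt_of_le_of_ne (hP m) hm.symm) (hQ m)).ne'

theorem coeff_natCast_mul_nonneg (c : ℕ) (hP : ∀ m, 0 ≤ P.coeff m) (m : σ →₀ ℕ) :
    0 ≤ ((c : MvPolynomial σ ℚ) * P).coeff m := by
  rw [← map_natCast (C : ℚ →+* MvPolynomial σ ℚ), coeff_C_mul]
  exact mul_nonneg (Nat.cast_nonneg c) (hP m)

theorem quadratic (c : ℕ) (hP : IsPositive P) (hQ : IsPositive Q) :
    IsPositive (P * P + Q * Q + (c : MvPolynomial σ ℚ) * (P * Q)) :=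
  ((hP.mul hP).add_of_nonneg (hQ.mul hQ).2).add_of_nonneg
    (coeff_natCast_mul_nonneg c (hP.mul hQ).2)

/-- The two squares survive in the sum, and the cross term has degree at most `deg P + deg Q`, so
`c` plays no role. -/
theorem degreeOf_quadratic (l : σ) (c : ℕ) (hP : IsPositive P) (hQ : IsPositive Q) :
    degreeOf l (P * P + Q * Q + (c : MvPolynomial σ ℚ) * (P * Q)) = 2 * max (degreeOf l P) (degreeOf l Q) := by
  have hPP := degreeOf_mul_eq (n := l) hP.1 hP.1
  have hQQ := degreeOf_mul_eq (n := l) hQ.1 hQ.1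
  have hPQ := degreeOf_mul_eq (n := l) hP.1 hQ.1
  have h1 := degreeOf_le_add l (hP.mul hP).2 (hQ.mul hQ).2
  have h2 := degreeOf_le_add l (hQ.mul hQ).2 (hP.mul hP).2
  rw [add_comm] at h2
  have h3 := degreeOf_le_add l ((hP.mul hP).add_of_nonneg (hQ.mul hQ).2).2
    (coeff_natCast_mul_nonneg c (hP.mul hQ).2)
  have h4 := degreeOf_add_le l (P * P) (Q * Q)
  have h5 := degreeOf_add_le l (P * P + Q * Q) ((c : MvPolynomial σ ℚ) * (P * Q))
  have h6 : degreeOf l ((c : MvPolynomial σ ℚ) * (P * Q)) ≤ degreeOf l (P * Q) := by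
    rw [← map_natCast (C : ℚ →+* MvPolynomial σ ℚ)]
    exact degreeOf_C_mul_le _ _ _
  omega

end IsPositive

/-- `f` is a quotient of two positive polynomials whose degrees in the variable `l` have a sum
congruent to `e` modulo `2`. -/
def HasDegreeParity (l : σ) (f : FractionRing (MvPolynomial σ ℚ)) (e : ZMod 2) : Prop :=
  ∃ P Q : MvPolynomial σ ℚ, IsPositive P ∧ IsPositive Q ∧
    f = algebraMap _ _ P / algebraMap _ _ Q ∧ ((degreeOf l P + degreeOf l Q : ℕ) : ZMod 2) = e

theorem algebraMap_fractionRing_ne_zero {P : MvPolynomial σ ℚ} (hP : P ≠ 0) :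
    algebraMap _ (FractionRing (MvPolynomial σ ℚ)) P ≠ 0 :=
  (map_ne_zero_iff _ (IsFractionRing.injective _ _)).2 hP

/-! ### Degrees modulo 2 of subtraction-free quotients -/

namespace HasDegreeParity

variable {l : σ} {f g h : FractionRing (MvPolynomial σ ℚ)} {e e' e'' : ZMod 2}

theorem ne_zero (hf : HasDegreeParity l f e) : f ≠ 0 := by
  obtain ⟨P, Q, hP, hQ, rfl, -⟩ := hf
  exact div_ne_zero (algebraMap_fractionRing_ne_zero hP.1) (algebraMap_fractionRing_ne_zero hQ.1)

theorem unique (hf : HasDegreeParity l f e) (hf' : HasDegreeParity l f e') : e = e' := by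
  obtain ⟨P, Q, hP, hQ, rfl, rfl⟩ := hf
  obtain ⟨P', Q', hP', hQ', h, rfl⟩ := hf'
  rw [div_eq_div_iff (algebraMap_fractionRing_ne_zero hQ.1)
    (algebraMap_fractionRing_ne_zero hQ'.1), ← map_mul, ← map_mul] at h
  have hd := congrArg (degreeOf l) (IsFractionRing.injective _ _ h)
  rw [degreeOf_mul_eq hP.1 hQ'.1, degreeOf_mul_eq hP'.1 hQ.1] at hd
  rw [ZMod.natCast_eq_natCast_iff']
  omega

theorem X (l i : σ) [DecidableEq σ] :
    HasDegreeParity l (algebraMap (MvPolynomial σ ℚ) _ (MvPolynomial.X i)) (if l = i then 1 else 0) := by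
  refine ⟨.X i, 1, .X i, .one, by simp, ?_⟩
  rw [degreeOf_X, degreeOf_one]
  split_ifs <;> simp

/-- The exchange relation `f f' = g² + h² + c g h` preserves degree parities. -/
theorem exchange (c : ℕ) (hf : HasDegreeParity l f e) (hg : HasDegreeParity l g e')
    (hh : HasDegreeParity l h e'') :
    HasDegreeParity l (f⁻¹ * (g ^ 2 + h ^ 2 + c * (g * h))) e := by
  obtain ⟨P, Q, hP, hQ, rfl, rfl⟩ := hf
  obtain ⟨R, S, hR, hS, rfl, -⟩ := hg
  obtain ⟨T, U, hT, hU, rfl, -⟩ := hh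
  -- Over the common denominator `S * U`, the numerators of `g` and `h` are `R * U` and `T * S`.
  have hRU : IsPositive (R * U) := hR.mul hU
  have hTS : IsPositive (T * S) := hT.mul hS
  have hSU : IsPositive (S * U) := hS.mul hU
  refine ⟨Q * (R * U * (R * U) + T * S * (T * S) + c * (R * U * (T * S))),
    P * (S * U * (S * U)), hQ.mul (hRU.quadratic c hTS), hP.mul (hSU.mul hSU), ?_, ?_⟩
  · have := algebraMap_fractionRing_ne_zero hP.1
    have := algebraMap_fractionRing_ne_zero hQ.1
    have := algebraMap_fractionRing_ne_zero hS.1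
    have := algebraMap_fractionRing_ne_zero hU.1
    simp only [map_mul, map_add, map_natCast]
    field_simp
  · rw [degreeOf_mul_eq hQ.1 (hRU.quadratic c hTS).1, degreeOf_mul_eq hP.1 (hSU.mul hSU).1,
      hRU.degreeOf_quadratic l c hTS, degreeOf_mul_eq hSU.1 hSU.1, ZMod.natCast_eq_natCast_iff']
    omega

end HasDegreeParity

end MvPolynomial

/-! ### Seeds and exchange relations of the Markov pattern -/

namespace GenMarkov

open MvPolynomial (HasDegreeParity)

theorem natDegree_initialSeed_Z (k : Fin 3 → ℕ) (j : Fin 3) :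
    ((initialSeed k).Z j).natDegree = if k j = 0 then 1 else 2 := by
  simp only [initialSeed]
  split_ifs <;> compute_degree!

theorem reverse_initialSeed_Z (k : Fin 3 → ℕ) (j : Fin 3) :
    ((initialSeed k).Z j).reverse = (initialSeed k).Z j := by
  have hd := natDegree_initialSeed_Z k j
  rw [Polynomial.reverse, hd]
  simp only [initialSeed]
  split_ifs
  · rw [Polynomial.reflect_add, Polynomial.reflect_one, Polynomial.reflect_one_X]
    ring
  · have h1 := Polynomial.reflect_C_mul_X_pow 2 1 (c := k j)
    simp [Polynomial.revAt_le] at h1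
    simp [Polynomial.reflect_add, h1]
    ring

/-- The labeled seeds that differ from the initial one only in their cluster and in the sign of
their exchange matrix. -/
structure IsMarkovSeed (k : Fin 3 → ℕ) (s : LabeledSeed (Fin 3) AmbientField) : Prop where
  B_eq : s.B = (initialSeed k).B ∨ s.B = -(initialSeed k).B
  Z_eq : s.Z = (initialSeed k).Z

/-- Since `d_l c_l = 2` in both cases, an off-diagonal entry `b` away from `l` becomes `b - 2b`. The
polynomials are palindromic. -/
theorem IsMarkovSeed.mutate {k : Fin 3 → ℕ} {s : LabeledSeed (Fin 3) AmbientField}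
    (hs : IsMarkovSeed k s) (l : Fin 3) : IsMarkovSeed k (s.mutate l) := by
  obtain ⟨hB, hZ⟩ := hs
  refine ⟨?_, ?_⟩
  · have hd : s.d l = if k l = 0 then 1 else 2 := by
      rw [LabeledSeed.d, hZ, natDegree_initialSeed_Z]
    rcases hB with hB | hB
    · right
      ext i j
      simp only [LabeledSeed.mutate, Matrix.of_apply, hB, hd]
      fin_cases l <;> fin_cases i <;> fin_cases j <;>
        simp [initialSeed, colEntry] <;> split_ifs <;> simp
    · left
      ext i j
      simp only [LabeledSeed.mutate, Matrix.of_apply, hB, hd]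
      fin_cases l <;> fin_cases i <;> fin_cases j <;>
        simp [initialSeed, colEntry] <;> split_ifs <;> simp
  · funext j
    simp only [LabeledSeed.mutate, hZ, reverse_initialSeed_Z]
    split_ifs with h
    · rw [h]
    · rfl

/-- The relation is symmetric in the two other variables, so the sign of `B` is immaterial. -/
theorem IsMarkovSeed.newVariable_eq {k : Fin 3 → ℕ} {s : LabeledSeed (Fin 3) AmbientField}
    (hs : IsMarkovSeed k s) (h0 : ∀ i, s.cluster i ≠ 0) (l : Fin 3) :
    s.newVariable l = (s.cluster l)⁻¹ * (s.cluster (l + 1) ^ 2 + s.cluster (l + 2) ^ 2 +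
      k l * (s.cluster (l + 1) * s.cluster (l + 2))) := by
  obtain ⟨hB, hZ⟩ := hs
  have hd : s.d l = if k l = 0 then 1 else 2 := by
    rw [LabeledSeed.d, hZ, natDegree_initialSeed_Z]
  rw [LabeledSeed.newVariable, hd, hZ, mul_assoc]
  congr 1
  by_cases hk : k l = 0 <;> rcases hB with hB | hB <;> fin_cases l <;>
    simp_all [initialSeed, colEntry, Fin.prod_univ_three] <;>
    have a0 := h0 0 <;> have a1 := h0 1 <;> have a2 := h0 2 <;> field_simp <;> ring

theorem isMarkovSeed_and_hasDegreeParity (k : Fin 3 → ℕ) (w : List (Fin 3)) :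
    IsMarkovSeed k (w.foldr LabeledSeed.mutate (initialSeed k)) ∧
      ∀ l i, HasDegreeParity l ((w.foldr LabeledSeed.mutate (initialSeed k)).cluster i)
        (if l = i then 1 else 0) := by
  induction w with
  | nil => exact ⟨⟨Or.inl rfl, rfl⟩, fun l i => HasDegreeParity.X l i⟩
  | cons m w ih =>
    obtain ⟨hs, hp⟩ := ih
    rw [List.foldr_cons]
    refine ⟨hs.mutate m, fun l i => ?_⟩
    by_cases him : i = m
    · subst him
      have hx : ((w.foldr LabeledSeed.mutate (initialSeed k)).mutate i).cluster i =
          (w.foldr LabeledSeed.mutate (initialSeed k)).newVariable i := if_pos rfl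
      rw [hx, hs.newVariable_eq fun j => (hp j j).ne_zero]
      exact (hp l i).exchange (k i) (hp l (i + 1)) (hp l (i + 2))
    · have hx : ((w.foldr LabeledSeed.mutate (initialSeed k)).mutate m).cluster i =
          (w.foldr LabeledSeed.mutate (initialSeed k)).cluster i := if_neg him
      rw [hx]
      exact hp l i

theorem AppearsAt.unique {k : Fin 3 → ℕ} {x : AmbientField} {i j : Fin 3}
    (hi : AppearsAt k x i) (hj : AppearsAt k x j) : i = j := by
  obtain ⟨t, rfl⟩ := hi
  obtain ⟨u, hu⟩ := hj
  have ht := (isMarkovSeed_and_hasDegreeParity k t.1).2 i i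
  have hu' : HasDegreeParity i (labeledCluster k u j) _ :=
    (isMarkovSeed_and_hasDegreeParity k u.1).2 i j
  rw [hu] at hu'
  have h := ht.unique hu'
  by_contra hij
  -- For `i ≠ j`, `h` says `1 = 0` in `ZMod 2`.
  simp [hij] at h

end GenMarkov

theorem mainTheorem12 (k : Fin 3 → ℕ) (x : GenMarkov.AmbientField)
    (hx : GenMarkov.IsClusterVariable k x) :
    (∃! i : Fin 3, GenMarkov.AppearsAt k x i) ∧ (∃! κ : ℕ, GenMarkov.IsParity k x κ) := by
  obtain ⟨t, i, hi⟩ := hx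
  have hx : GenMarkov.AppearsAt k x i := ⟨t, hi⟩
  refine ⟨⟨i, hx, fun j hj => hj.unique hx⟩, ⟨k i, ⟨i, hx, rfl⟩, ?_⟩⟩
  rintro κ ⟨j, hj, rfl⟩
  rw [hj.unique hx]
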